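/- **Theorem (unforgeable banknotes, sampling).** Let $k,n,t\in\mathbb N$ and $N=2^{n+1}$. *Scheme.* A banknote is a register of $N$ qubits in the maximally mixed state $\pi_N$, i.e. in $|x\rangle$ for a uniformly random $x\in\{0,1\}^N$. When emitting it, the bank draws $k$ independent samples $s_1,\dots,s_k$, each consisting of $t$ independent uniformly random positions in $[1,N]$, and records $x$ at these positions. At the $j$-th inquiry about the banknote ($j<k$: a spending; $j=k$: the re-emission at the bank) a register of $N$ qubits is presented; the verifier measures it in the computational basis at the positions $s_j$ and accepts if and only if all $t$ outcomes agree with the recorded values $x_{s_j}$. *Adversary.* An adversary with free energy $2^n$ holds the genuine banknote, $2^n$ blank qubits in the state $|0\rangle$, and an arbitrary finite number of further qubits in the maximally mixed state; its computing power is unbounded. Before each inquiry it applies an arbitrary unitary to all the registers in its hands, and then it presents a register of $N$ qubits. After the inquiry it learns the verdict, and it is told $s_j$ and $x_{s_j}$; this message is received by adding it bitwise modulo 2 to the content of registers of the adversary, so that it occupies blank memory of the adversary if it is to be readable. A presented register stays with the honest parties or is handed back later; when it is handed back is also chosen by the adversary, adaptively in the verdicts. The banknote is *forged* if there are two inquiries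 $i<j$ at both of which the presented register is accepted, while the register accepted at inquiry $i$ has not been handed back before inquiry $j$ (so that two valid copies of the single banknote are in the hands of honest parties). *Claim.* The probability of forging is exponentially small in $\min(n,t)$: there is a universal constant $c>0$, and for every $k$ a constant $C>0$ depending only on $k$, such that for all $n,t$ and every such adversary (whatever the size of its mixed memory) $$\Pr[\text{the banknote is forged}]\;\le\; C\cdot 2^{-c\,\min(n,t)} .$$ -/

import Mathlib

open scoped BigOperators

namespace Banknote

/-- A classical bit; the addition is XOR. -/
abbrev Bit : Type := ZMod 2

/-- A position in a banknote: one of `2 ^ (n + 1)` addresses, written with `n + 1` bits. -/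
abbrev Pos (n : ℕ) : Type := Fin (n + 1) → Bit

/-- Computational-basis labels of a banknote register, which has `2 ^ (n + 1)` qubits. -/
abbrev Note (n : ℕ) : Type := Pos n → Bit

/-- What the bank says about one sample of size `t`: the positions and the recorded values. -/
abbrev Msg (n t : ℕ) : Type := Fin t → Pos n × Bit

/-- Labels of the registers that come from the environment and start maximally mixed:
the `k` registers which will be presented as the banknote at the `k` inquiries,
an inbox in which announcements of the bank are received, and `M` further qubits. -/
abbrev Ambient (n k t M : ℕ) : Type := (Fin k → Note n) × Msg n t × (Fin M → Bit)

/-- Computational-basis labels of all registers: the ambient registers, the register with the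
genuine banknote, and the `2 ^ n` qubits which start blank (the free energy). -/
abbrev Memory (n k t M : ℕ) : Type := Ambient n k t M × Note n × (Fin (2 ^ n) → Bit)

instance (n t : ℕ) : DecidableEq (Msg n t) := inferInstance

instance (n k t M : ℕ) : DecidableEq (Ambient n k t M) := instDecidableEqProd

instance (n k t M : ℕ) : DecidableEq (Memory n k t M) := instDecidableEqProd

section Game

variable {n k t M : ℕ}

/-- Content of the register presented at inquiry `i`. -/
def presented (w : Memory n k t M) (i : Fin k) : Note n := w.1.1 i

/-- Overwrite the label of the register presented at inquiry `i`. -/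
def setPresented (w : Memory n k t M) (i : Fin k) (b : Note n) : Memory n k t M :=
  ((Function.update w.1.1 i b, w.1.2), w.2)

/-- `U` is the identity on the register presented at inquiry `i`, tensored with an operator
on all the other registers. -/
def ActsTriviallyOn (i : Fin k) (U : Matrix (Memory n k t M) (Memory n k t M) ℂ) : Prop :=
  (∀ w w', presented w i ≠ presented w' i → U w w' = 0) ∧
  (∀ w w' b, presented w i = presented w' i →
    U (setPresented w i b) (setPresented w' i b) = U w w')

/-- Accept/reject outcomes of the inquiries before inquiry `j`. -/
abbrev History {k : ℕ} (j : Fin k) : Type := {i : Fin k // i < j} → Bool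

/-- An adversary with free energy `2 ^ n`. Before inquiry `j`, knowing the earlier verdicts, it
applies the unitary `op j h` to all registers it has in hand. `held j h` is the set of those
registers, presented at earlier inquiries, that are kept by the honest parties at that moment:
the adversary has no access to them. A register outside `held j h` is back in its hands. -/
structure Adversary (n k t M : ℕ) where
  op : (j : Fin k) → History j → Matrix (Memory n k t M) (Memory n k t M) ℂ
  op_unitary : ∀ j h, op j h ∈ Matrix.unitaryGroup (Memory n k t M) ℂ
  held : (j : Fin k) → History j → Finset (Fin k)
  op_trivial : ∀ j h, ∀ i ∈ held j h, ActsTriviallyOn i (op j h)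

/-- Values of the note `x` at the positions of the sample `s`. -/
def sampleAt (x : Note n) (s : Fin t → Pos n) : Fin t → Bit := fun a => x (s a)

/-- The verdict at inquiry `j`, when the note was emitted with content `x`, the bank sampled it at
the positions `s`, and the verifier observed the values `o j` at the positions `s j`. -/
def verdict (x : Note n) (s : Fin k → Fin t → Pos n) (o : Fin k → Fin t → Bit) (j : Fin k) : Bool :=
  decide (o j = sampleAt x (s j))

/-- The verdicts before inquiry `j`. -/
def history (x : Note n) (s : Fin k → Fin t → Pos n) (o : Fin k → Fin t → Bit) (j : Fin k) :
    History j :=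
  fun i => verdict x s o i

/-- Projection onto the outcome `v` of the measurement, in the computational basis, of the
register presented at inquiry `j`, at the positions `s`. -/
def observe (j : Fin k) (s : Fin t → Pos n) (v : Fin t → Bit) (ψ : Memory n k t M → ℂ) :
    Memory n k t M → ℂ :=
  fun w => if sampleAt (presented w j) s = v then ψ w else 0

/-- The message `m` is told to the adversary: the basis state with inbox content `c` becomes the
one with inbox content `c + m`. (So `m` is readable as far as the adversary has moved
blank memory into the inbox before.) -/
def announce (m : Msg n t) (ψ : Memory n k t M → ℂ) : Memory n k t M → ℂ :=
  fun w => ψ ((w.1.1, w.1.2.1 - m, w.1.2.2), w.2)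

/-- The initial vector: genuine note `x`, ambient content `r`, and blank memory `0`. -/
def initial (x : Note n) (r : Ambient n k t M) : Memory n k t M → ℂ :=
  Pi.single (r, x, 0) 1

/-- Inquiry `j`: the adversary acts, the presented register is sampled with observed values `o j`,
and the positions and recorded values of the `j`-th sample are announced. -/
def inquiry (A : Adversary n k t M) (x : Note n) (s : Fin k → Fin t → Pos n)
    (o : Fin k → Fin t → Bit) (j : Fin k) (ψ : Memory n k t M → ℂ) : Memory n k t M → ℂ :=
  announce (fun a => (s j a, x (s j a)))
    (observe j (s j) (o j) ((A.op j (history x s o j)).mulVec ψ))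

/-- The unnormalised vector after the first `m` inquiries, along the branch where the observed
values are `o`. -/
def stateAfter (A : Adversary n k t M) (x : Note n) (s : Fin k → Fin t → Pos n)
    (o : Fin k → Fin t → Bit) (r : Ambient n k t M) : ℕ → Memory n k t M → ℂ
  | 0 => initial x r
  | m + 1 => if h : m < k then inquiry A x s o ⟨m, h⟩ (stateAfter A x s o r m)
      else stateAfter A x s o r m

/-- Probability (Born rule) that the observed values are `o`. -/
noncomputable def branchProb (A : Adversary n k t M) (x : Note n) (s : Fin k → Fin t → Pos n)
    (r : Ambient n k t M) (o : Fin k → Fin t → Bit) : ℝ :=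
  ∑ w, ‖stateAfter A x s o r k w‖ ^ 2

/-- The banknote was forged: at two inquiries `i < j` the presented register was accepted, and the
register accepted at `i` stayed with the honest parties until the one presented at `j` was
accepted, so that these are two banknotes in place of a single one. -/
def Forged (A : Adversary n k t M) (x : Note n) (s : Fin k → Fin t → Pos n)
    (o : Fin k → Fin t → Bit) : Prop :=
  ∃ i j : Fin k, i < j ∧ verdict x s o i = true ∧ verdict x s o j = true ∧
    ∀ l : Fin k, i < l → l ≤ j → i ∈ A.held l (history x s o l)

open Classical in
/-- Probability that the adversary forges the banknote. The note `x`, the `k` samples of `t`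
positions and the ambient registers are independent and uniform. -/
noncomputable def forgeProb (A : Adversary n k t M) : ℝ :=
  𝔼 x : Note n, 𝔼 s : Fin k → Fin t → Pos n, 𝔼 r : Ambient n k t M,
    ∑ o : Fin k → Fin t → Bit, if Forged A x s o then branchProb A x s r o else 0

end Game

end Banknote

/-! Put N = 2 ^ (n + 1), and call a note far from `x` if it differs from it in more than N / 32
positions, near otherwise. A random sample misses the difference of a far note with probability at
most (31/32)^t (`expect_sampleAt_eq_le`), and a Chernoff bound shows that near notes are rare
(`card_near_sq_le`).

Suppose first that the operations ignore the verdicts. For fixed `x` and samples, every inquiry is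
then a unital channel: a unitary, a basis measurement, a shift of the inbox. The initial state,
averaged over the ambient registers, is at most 2^(N + 2^n) times the maximally mixed state of the
whole memory, and unitality preserves this domination. If b notes are near, two registers are both
near with probability at most 2^(N + 2^n) (b / 2^N)^2 = b^2 / 2^(2^n), which is small
(`expect_branchSum_both_near_le`). A register that is kept does not change its probability of being
far (`weight_contentIn_mulVec`), so two acceptances mean that a far register was accepted or that
both are near (`expect_two_accepted_le`).

Adaptivity costs a union bound: on a branch with verdict table `h` the adversary agrees with the one
that follows `h` blindly (`stateAfter_eq_run`). The bound holds for each `x` separately. -/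

namespace Banknote

/-! ### Resampling one coordinate of a uniform family -/

section Averages

variable {ι α : Type*} [Fintype ι] [DecidableEq ι] [Fintype α]

/-- Averaging over a family is not affected by resampling one of its members. -/
theorem expect_update (F : (ι → α) → ℝ) (i : ι) :
    𝔼 f, 𝔼 a, F (Function.update f i a) = 𝔼 f, F f := by
  rcases isEmpty_or_nonempty (ι → α) with h | h
  · simp
  have : Nonempty α := h.map fun f => f i
  -- Swapping the fresh value with the old coordinate is an involution.
  let e : (ι → α) × α ≃ (ι → α) × α :=
    { toFun := fun p => (Function.update p.1 i p.2, p.1 i)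
      invFun := fun p => (Function.update p.1 i p.2, p.1 i)
      left_inv := fun p => by simp
      right_inv := fun p => by simp }
  calc 𝔼 f, 𝔼 a, F (Function.update f i a)
      = 𝔼 p : (ι → α) × α, F (e p).1 := by
        rw [← Finset.univ_product_univ, Finset.expect_product]; rfl
    _ = 𝔼 p : (ι → α) × α, F p.1 := Fintype.expect_equiv e _ _ fun _ => rfl
    _ = 𝔼 f, F f := by
        rw [← Finset.univ_product_univ, Finset.expect_product]
        simp

theorem card_mul_expect_eq_sum_update (F : (ι → α) → ℝ) (i : ι) :
    (Fintype.card α : ℝ) * 𝔼 f, F f = 𝔼 f, ∑ a, F (Function.update f i a) := by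
  rw [← expect_update F i, Finset.mul_expect]
  simp_rw [Fintype.card_mul_expect]

end Averages

/-! ### Hamming balls: detection of far notes, scarcity of near ones -/

section Codes

variable {n : ℕ}

/-- The notes that differ from `x` in more than a fraction `1 / 32` of the positions. -/
def far (x : Note n) : Finset (Note n) := {y | 2 ^ (n + 1) < 32 * hammingDist y x}

theorem card_pos : Fintype.card (Pos n) = 2 ^ (n + 1) := by simp [ZMod.card]

/-- A random sample fails to notice a far note with exponentially small probability. -/
theorem expect_sampleAt_eq_le {x y : Note n} (h : y ∈ far x) (t : ℕ) :
    𝔼 s : Fin t → Pos n, (if sampleAt y s = sampleAt x s then (1 : ℝ) else 0) ≤ (31 / 32) ^ t := by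
  have hcard : (Finset.univ.filter fun s : Fin t → Pos n => sampleAt y s = sampleAt x s)
      = Fintype.piFinset fun _ => Finset.univ.filter fun p => y p = x p := by
    ext s
    simp [sampleAt, funext_iff, Fintype.mem_piFinset]
  have hsplit : (Finset.univ.filter fun p => y p = x p).card + hammingDist y x = 2 ^ (n + 1) := by
    rw [← card_pos, ← Finset.card_univ, hammingDist]
    exact Finset.card_filter_add_card_filter_not _
  have hfar : 2 ^ (n + 1) < 32 * hammingDist y x := by simpa [far] using h
  rw [Fintype.expect_eq_sum_div_card, Finset.sum_boole, hcard, Fintype.card_piFinset]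
  simp only [Finset.prod_const, Finset.card_univ, Fintype.card_fin, Nat.cast_pow, Fintype.card_pi]
  rw [← div_pow]
  refine pow_le_pow_left₀ (by positivity) ?_ t
  rw [ZMod.card, div_le_iff₀ (by positivity)]
  have h1 : ((Finset.univ.filter fun p => y p = x p).card : ℝ) + hammingDist y x
    = 2 ^ (n + 1) := by exact_mod_cast hsplit
  have h2 : (2 : ℝ) ^ (n + 1) < 32 * hammingDist y x := by exact_mod_cast hfar
  push_cast
  linarith

/-- The summand factors over the positions, and each position contributes 1 if it agrees and `a` if
it does not. This is the moment generating function of the Chernoff bound. -/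
theorem sum_pow_hammingDist (x : Note n) (a : ℝ) :
    ∑ y : Note n, a ^ hammingDist y x = (1 + a) ^ 2 ^ (n + 1) := by
  have h1 : ∀ y : Note n, a ^ hammingDist y x = ∏ p, if y p = x p then 1 else a := by
    intro y
    rw [Finset.prod_ite]
    simp [hammingDist]
  have h2 : ∀ b : Bit, ∑ c : Bit, (if c = b then 1 else a) = 1 + a := by
    intro b
    rw [← Finset.add_sum_erase _ _ (Finset.mem_univ b), if_pos rfl,
      Finset.sum_congr rfl fun c hc => if_neg (Finset.ne_of_mem_erase hc)]
    simp [ZMod.card]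
  simp_rw [h1]
  rw [← Fintype.prod_sum fun p (c : Bit) => if c = x p then 1 else a]
  simp_rw [h2]
  rw [Finset.prod_const, Finset.card_univ, card_pos]

/-- The number of pairs of notes near `x` is exponentially smaller than `2 ^ 2 ^ n`. -/
theorem card_near_sq_le (x : Note n) :
    (((far x)ᶜ.card : ℝ)) ^ 2 ≤ (31 / 32) ^ n * 2 ^ 2 ^ n := by
  -- Each differing position gets weight `a ^ 32` = 1/16, so a near note weighs at least `a ^ N`.
  -- The eighth root makes 2^(2^n) equal to `a ^ (-4 N)`, and everything becomes an N-th power.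
  obtain ⟨a, ha0, ha⟩ : ∃ a : ℝ, 0 < a ∧ a ^ 8 = 1 / 2 :=
    ⟨(1 / 2) ^ (1 / 8 : ℝ), by positivity, by
      rw [← Real.rpow_natCast, ← Real.rpow_mul (by norm_num)]; norm_num⟩
  have ha1 : a ≤ 1 := by
    by_contra! h
    have := one_lt_pow₀ h (n := 8) (by norm_num)
    linarith
  have hsum : ((far x)ᶜ.card : ℝ) * a ^ 2 ^ (n + 1) ≤ (17 / 16) ^ 2 ^ (n + 1) := by
    calc ((far x)ᶜ.card : ℝ) * a ^ 2 ^ (n + 1) = ∑ y ∈ (far x)ᶜ, a ^ 2 ^ (n + 1) := by simp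
      _ ≤ ∑ y ∈ (far x)ᶜ, (a ^ 32) ^ hammingDist y x := by
          refine Finset.sum_le_sum fun y hy => ?_
          rw [← pow_mul]
          exact pow_le_pow_of_le_one ha0.le ha1 (by simpa [far] using hy)
      _ ≤ ∑ y, (a ^ 32) ^ hammingDist y x :=
          Finset.sum_le_sum_of_subset_of_nonneg (Finset.subset_univ _)
            fun _ _ _ => by positivity
      _ = (17 / 16) ^ 2 ^ (n + 1) := by
          rw [sum_pow_hammingDist, show a ^ 32 = (a ^ 8) ^ 4 by ring, ha]; norm_num
  have ha2 : a ^ 2 * (17 / 16) ^ 2 ≤ 31 / 32 := by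
    have : a ^ 2 ≤ 31 / 32 * (16 / 17) ^ 2 := by
      refine le_of_pow_le_pow_left₀ (n := 4) (by norm_num) (by norm_num) ?_
      rw [← pow_mul, ha]
      norm_num
    calc a ^ 2 * (17 / 16) ^ 2 ≤ 31 / 32 * (16 / 17) ^ 2 * (17 / 16) ^ 2 := by gcongr
      _ = 31 / 32 := by norm_num
  have hpow : (2 : ℝ) ^ 2 ^ n * (a ^ 2 ^ (n + 1)) ^ 4 = 1 := by
    rw [← pow_mul, show 2 ^ (n + 1) * 4 = 8 * 2 ^ n by ring, pow_mul, ha, ← mul_pow]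
    norm_num
  have hA : 0 < a ^ 2 ^ (n + 1) := by positivity
  calc (((far x)ᶜ.card : ℝ)) ^ 2
      = ((((far x)ᶜ.card : ℝ) * a ^ 2 ^ (n + 1)) ^ 2 * (a ^ 2 ^ (n + 1)) ^ 2) * 2 ^ 2 ^ n := by
        linear_combination (-(((far x)ᶜ.card : ℝ)) ^ 2) * hpow
    _ ≤ (((17 / 16) ^ 2 ^ (n + 1)) ^ 2 * (a ^ 2 ^ (n + 1)) ^ 2) * 2 ^ 2 ^ n := by gcongr
    _ = (a ^ 2 * (17 / 16) ^ 2) ^ 2 ^ (n + 1) * 2 ^ 2 ^ n := by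
        rw [mul_pow, pow_right_comm a, pow_right_comm (17 / 16 : ℝ), mul_comm (_ ^ 2 ^ (n + 1))]
    _ ≤ (31 / 32) ^ 2 ^ (n + 1) * 2 ^ 2 ^ n := by gcongr
    -- A doubly exponential gain is given up here; only `n` matters beside `t`.
    _ ≤ (31 / 32) ^ n * 2 ^ 2 ^ n := by
        gcongr ?_ * _
        exact pow_le_pow_of_le_one (by norm_num) (by norm_num)
          ((Nat.lt_two_pow_self).le.trans (Nat.pow_le_pow_right (by norm_num) n.le_succ))

end Codes

/-! ### Single inquiries: preserved weights and transposes -/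

section Inquiries

variable {n k t M : ℕ}

/-- Squared norm of `ψ`, weighted by a function of the presented registers. -/
noncomputable def weight (f : (Fin k → Note n) → ℝ) (ψ : Memory n k t M → ℂ) : ℝ :=
  ∑ w, f w.1.1 * ‖ψ w‖ ^ 2

theorem weight_nonneg {f : (Fin k → Note n) → ℝ} (hf : ∀ p, 0 ≤ f p) (ψ : Memory n k t M → ℂ) :
    0 ≤ weight f ψ :=
  Finset.sum_nonneg fun w _ => mul_nonneg (hf _) (by positivity)

theorem weight_mono {f g : (Fin k → Note n) → ℝ} (h : ∀ p, f p ≤ g p) (ψ : Memory n k t M → ℂ) :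
    weight f ψ ≤ weight g ψ :=
  Finset.sum_le_sum fun w _ => mul_le_mul_of_nonneg_right (h _) (by positivity)

theorem weight_add (f g : (Fin k → Note n) → ℝ) (ψ : Memory n k t M → ℂ) :
    weight (f + g) ψ = weight f ψ + weight g ψ := by
  simp [weight, add_mul, Finset.sum_add_distrib]

/-- Adding `m` to the inbox. -/
def addInbox (m : Msg n t) : Memory n k t M ≃ Memory n k t M where
  toFun w := ((w.1.1, w.1.2.1 + m, w.1.2.2), w.2)
  invFun w := ((w.1.1, w.1.2.1 - m, w.1.2.2), w.2)
  left_inv w := by simp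
  right_inv w := by simp

theorem weight_announce (f : (Fin k → Note n) → ℝ) (m : Msg n t) (ψ : Memory n k t M → ℂ) :
    weight f (announce m ψ) = weight f ψ :=
  Fintype.sum_equiv (addInbox m).symm _ _ fun _ => rfl

/-- The measurement is diagonal in the basis that `f` refers to: each basis label survives for
exactly one outcome. -/
theorem sum_weight_observe (f : (Fin k → Note n) → ℝ) (j : Fin k) (s : Fin t → Pos n)
    (ψ : Memory n k t M → ℂ) : ∑ v, weight f (observe j s v ψ) = weight f ψ := by
  simp only [weight]
  rw [Finset.sum_comm]
  refine Finset.sum_congr rfl fun w _ => ?_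
  rw [Finset.sum_eq_single (sampleAt (presented w j) s)]
  · simp [observe]
  · intro v _ hv
    simp [observe, hv.symm]
  · simp

theorem weight_one_mulVec {U : Matrix (Memory n k t M) (Memory n k t M) ℂ}
    (hU : U ∈ Matrix.unitaryGroup (Memory n k t M) ℂ) (ψ : Memory n k t M → ℂ) :
    weight 1 (U.mulVec ψ) = weight 1 ψ := by
  have key : ∀ φ : Memory n k t M → ℂ, ((weight 1 φ : ℝ) : ℂ) = star φ ⬝ᵥ φ := by
    intro φ
    simp [weight, dotProduct, ← Complex.conj_mul']
  apply Complex.ofReal_injective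
  rw [key, key, Matrix.star_mulVec, ← Matrix.dotProduct_mulVec, Matrix.mulVec_mulVec,
    ← Matrix.star_eq_conjTranspose, Matrix.mem_unitaryGroup_iff'.mp hU, Matrix.one_mulVec]

theorem weight_one_vecMul {U : Matrix (Memory n k t M) (Memory n k t M) ℂ}
    (hU : U ∈ Matrix.unitaryGroup (Memory n k t M) ℂ) (φ : Memory n k t M → ℂ) :
    weight 1 (Matrix.vecMul φ U) = weight 1 φ := by
  have key : ∀ φ : Memory n k t M → ℂ, ((weight 1 φ : ℝ) : ℂ) = φ ⬝ᵥ star φ := by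
    intro φ
    simp [weight, dotProduct, ← Complex.mul_conj']
  apply Complex.ofReal_injective
  rw [key, key, Matrix.star_vecMul, ← Matrix.dotProduct_mulVec, Matrix.mulVec_mulVec,
    ← Matrix.star_eq_conjTranspose, Matrix.mem_unitaryGroup_iff.mp hU, Matrix.one_mulVec]

/-- The weight that tests whether the register presented at `i` has its content in `B`. -/
def contentIn (i : Fin k) (B : Finset (Note n)) (p : Fin k → Note n) : ℝ :=
  if p i ∈ B then 1 else 0

theorem contentIn_nonneg (i : Fin k) (B : Finset (Note n)) (p : Fin k → Note n) :
    0 ≤ contentIn i B p := by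
  unfold contentIn; split_ifs <;> norm_num

/-- `U` is block diagonal in the content of register `i`, hence commutes with the projection onto
contents in `B`. -/
theorem weight_contentIn_mulVec {U : Matrix (Memory n k t M) (Memory n k t M) ℂ}
    (hU : U ∈ Matrix.unitaryGroup (Memory n k t M) ℂ) {i : Fin k} (hi : ActsTriviallyOn i U)
    (B : Finset (Note n)) (ψ : Memory n k t M → ℂ) :
    weight (contentIn i B) (U.mulVec ψ) = weight (contentIn i B) ψ := by
  let cut : (Memory n k t M → ℂ) → Memory n k t M → ℂ :=
    fun φ w => if presented w i ∈ B then φ w else 0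
  have hcut : ∀ φ, weight (contentIn i B) φ = weight 1 (cut φ) := by
    intro φ
    refine Finset.sum_congr rfl fun w _ => ?_
    by_cases h : w.1.1 i ∈ B <;> simp [contentIn, cut, presented, h]
  have hcomm : cut (U.mulVec ψ) = U.mulVec (cut ψ) := by
    ext w
    by_cases h : presented w i ∈ B
    · simp only [cut, if_pos h, Matrix.mulVec, dotProduct]
      refine Finset.sum_congr rfl fun w' _ => ?_
      by_cases h' : presented w' i ∈ B
      · simp [h']
      · rw [hi.1 w w' fun e => h' (e ▸ h)]; simp
    · simp only [cut, if_neg h, Matrix.mulVec, dotProduct]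
      symm
      refine Finset.sum_eq_zero fun w' _ => ?_
      by_cases h' : presented w' i ∈ B
      · rw [hi.1 w w' fun e => h (e ▸ h')]; simp
      · simp [h']
  rw [hcut, hcut, hcomm, weight_one_mulVec hU]

/-- An inquiry at which the adversary applies `U`. -/
def step (U : Matrix (Memory n k t M) (Memory n k t M) ℂ) (x : Note n) (j : Fin k)
    (s : Fin t → Pos n) (v : Fin t → Bit) (ψ : Memory n k t M → ℂ) : Memory n k t M → ℂ :=
  announce (fun a => (s a, x (s a))) (observe j s v (U.mulVec ψ))

theorem weight_step (f : (Fin k → Note n) → ℝ) (U : Matrix (Memory n k t M) (Memory n k t M) ℂ)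
    (x : Note n) (j : Fin k) (s : Fin t → Pos n) (v : Fin t → Bit) (ψ : Memory n k t M → ℂ) :
    weight f (step U x j s v ψ) = weight f (observe j s v (U.mulVec ψ)) :=
  weight_announce _ _ _

theorem sum_weight_step (f : (Fin k → Note n) → ℝ)
    (U : Matrix (Memory n k t M) (Memory n k t M) ℂ)
    (x : Note n) (j : Fin k) (s : Fin t → Pos n) (ψ : Memory n k t M → ℂ) :
    ∑ v, weight f (step U x j s v ψ) = weight f (U.mulVec ψ) := by
  simp_rw [weight_step, sum_weight_observe]

/-- The transpose of `step`. -/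
def backStep (U : Matrix (Memory n k t M) (Memory n k t M) ℂ) (x : Note n) (j : Fin k)
    (s : Fin t → Pos n) (v : Fin t → Bit) (φ : Memory n k t M → ℂ) : Memory n k t M → ℂ :=
  Matrix.vecMul (observe j s v (announce (-fun a => (s a, x (s a))) φ)) U

theorem dotProduct_step (U : Matrix (Memory n k t M) (Memory n k t M) ℂ) (x : Note n) (j : Fin k)
    (s : Fin t → Pos n) (v : Fin t → Bit) (φ ψ : Memory n k t M → ℂ) :
    φ ⬝ᵥ step U x j s v ψ = backStep U x j s v φ ⬝ᵥ ψ := by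
  rw [backStep, ← Matrix.dotProduct_mulVec]
  refine Fintype.sum_equiv (addInbox fun a => (s a, x (s a))).symm _ _ fun w => ?_
  simp only [step, announce, observe, addInbox, presented, Equiv.coe_fn_symm_mk, sub_neg_eq_add,
    sub_add_cancel]
  by_cases h : sampleAt (w.1.1 j) s = v <;> simp [h]

/-- This is unitality of one inquiry, stated as norm preservation by the transposed channel. -/
theorem sum_weight_backStep {U : Matrix (Memory n k t M) (Memory n k t M) ℂ}
    (hU : U ∈ Matrix.unitaryGroup (Memory n k t M) ℂ)
    (x : Note n) (j : Fin k) (s : Fin t → Pos n) (φ : Memory n k t M → ℂ) :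
    ∑ v, weight 1 (backStep U x j s v φ) = weight 1 φ := by
  simp_rw [backStep, weight_one_vecMul hU, sum_weight_observe, weight_announce]

/-! ### Runs with fixed operations and sums over their branches -/

/-- The unnormalised vector after `m` inquiries, when the adversary applies `U j` before inquiry
`j` whatever the verdicts. -/
def run (U : Fin k → Matrix (Memory n k t M) (Memory n k t M) ℂ) (x : Note n)
    (s : Fin k → Fin t → Pos n) (o : Fin k → Fin t → Bit) (ψ : Memory n k t M → ℂ) :
    ℕ → Memory n k t M → ℂ
  | 0 => ψ
  | m + 1 => if h : m < k then step (U ⟨m, h⟩) x ⟨m, h⟩ (s ⟨m, h⟩) (o ⟨m, h⟩) (run U x s o ψ m)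
      else run U x s o ψ m

variable {U : Fin k → Matrix (Memory n k t M) (Memory n k t M) ℂ} {x : Note n}

theorem run_succ (s : Fin k → Fin t → Pos n) (o : Fin k → Fin t → Bit)
    (ψ : Memory n k t M → ℂ) (j : Fin k) :
    run U x s o ψ (j + 1) = step (U j) x j (s j) (o j) (run U x s o ψ j) := by
  simp [run]

/-- Causality: later samples and outcomes cannot influence an earlier state. -/
theorem run_congr {s s' : Fin k → Fin t → Pos n} {o o' : Fin k → Fin t → Bit}
    (ψ : Memory n k t M → ℂ) {m : ℕ}
    (hs : ∀ l : Fin k, (l : ℕ) < m → s l = s' l) (ho : ∀ l : Fin k, (l : ℕ) < m → o l = o' l) :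
    run U x s o ψ m = run U x s' o' ψ m := by
  induction m with
  | zero => rfl
  | succ m ih =>
    simp only [run]
    rw [ih (fun l hl => hs l (by omega)) (fun l hl => ho l (by omega))]
    split_ifs with h
    · rw [hs ⟨m, h⟩ (Nat.lt_succ_self m), ho ⟨m, h⟩ (Nat.lt_succ_self m)]
    · rfl

theorem run_update_outcome (s : Fin k → Fin t → Pos n) (o : Fin k → Fin t → Bit)
    (ψ : Memory n k t M → ℂ) (j : Fin k) (v : Fin t → Bit) :
    run U x s (Function.update o j v) ψ j = run U x s o ψ j :=
  run_congr ψ (fun _ _ => rfl) fun l hl => Function.update_of_ne (by rintro rfl; omega) _ _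

theorem run_update_sample (s : Fin k → Fin t → Pos n) (o : Fin k → Fin t → Bit)
    (ψ : Memory n k t M → ℂ) (j : Fin k) (v : Fin t → Pos n) :
    run U x (Function.update s j v) o ψ j = run U x s o ψ j :=
  run_congr ψ (fun l hl => Function.update_of_ne (by rintro rfl; omega) _ _) fun _ _ => rfl

/-- Sum of `F` over the outcomes of the first `m` inquiries, when `F` depends on these only. -/
noncomputable def branchSum (m : ℕ) (F : (Fin k → Fin t → Bit) → ℝ) : ℝ :=
  (Fintype.card (Fin t → Bit) : ℝ) ^ m * 𝔼 o, F o

theorem branchSum_total (F : (Fin k → Fin t → Bit) → ℝ) : branchSum k F = ∑ o, F o := by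
  rw [branchSum, ← Fintype.card_mul_expect]
  simp

/-- The extra normalising factor turns the average over coordinate `j` into a sum, so inquiries can
be peeled off without changing the type of outcome tables. -/
theorem branchSum_succ (j : Fin k) (F : (Fin k → Fin t → Bit) → ℝ) :
    branchSum (j + 1) F = branchSum j fun o => ∑ v, F (Function.update o j v) := by
  rw [branchSum, branchSum, pow_succ, mul_assoc, card_mul_expect_eq_sum_update F j]

theorem branchSum_mono (m : ℕ) {F G : (Fin k → Fin t → Bit) → ℝ} (h : ∀ o, F o ≤ G o) :
    branchSum m F ≤ branchSum m G :=
  mul_le_mul_of_nonneg_left (Finset.expect_le_expect fun o _ => h o) (by positivity)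

theorem branchSum_add (m : ℕ) (F G : (Fin k → Fin t → Bit) → ℝ) :
    branchSum m (fun o => F o + G o) = branchSum m F + branchSum m G := by
  simp [branchSum, Finset.expect_add_distrib, mul_add]

theorem branchSum_sum {ι : Type*} (u : Finset ι) (m : ℕ) (F : ι → (Fin k → Fin t → Bit) → ℝ) :
    branchSum m (fun o => ∑ i ∈ u, F i o) = ∑ i ∈ u, branchSum m (F i) := by
  simp [branchSum, Finset.expect_sum_comm, Finset.mul_sum]

theorem branchSum_expect {ι : Type*} (u : Finset ι) (m : ℕ)
    (F : ι → (Fin k → Fin t → Bit) → ℝ) :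
    branchSum m (fun o => 𝔼 i ∈ u, F i o) = 𝔼 i ∈ u, branchSum m (F i) := by
  simp only [branchSum, ← Finset.mul_expect]
  rw [Finset.expect_comm]

/-- A weight respected by the operations between two inquiries is preserved between them. -/
theorem branchSum_weight_run_eq (s : Fin k → Fin t → Pos n) (ψ : Memory n k t M → ℂ)
    (Q : (Fin k → Fin t → Bit) → ℝ) (f : (Fin k → Note n) → ℝ) {a b : ℕ} (hab : a ≤ b) (hb : b ≤ k)
    (hQ : ∀ j : Fin k, a ≤ j → (j : ℕ) < b → ∀ o v, Q (Function.update o j v) = Q o)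
    (hU : ∀ j : Fin k, a ≤ j → (j : ℕ) < b → ∀ φ, weight f ((U j).mulVec φ) = weight f φ) :
    branchSum b (fun o => Q o * weight f (run U x s o ψ b))
      = branchSum a fun o => Q o * weight f (run U x s o ψ a) := by
  induction b, hab using Nat.le_induction with
  | base => rfl
  | succ b hab ih =>
    rw [← ih (by omega) (fun j h1 h2 => hQ j h1 (by omega)) fun j h1 h2 => hU j h1 (by omega)]
    obtain ⟨j, rfl⟩ : ∃ j : Fin k, (j : ℕ) = b := ⟨⟨b, by omega⟩, rfl⟩
    rw [branchSum_succ]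
    congr 1
    ext o
    simp_rw [run_succ, run_update_outcome, Function.update_self, hQ j hab (Nat.lt_succ_self _),
      ← Finset.mul_sum, sum_weight_step, hU j hab (Nat.lt_succ_self _)]

theorem branchSum_weight_one_run (hU : ∀ j, U j ∈ Matrix.unitaryGroup (Memory n k t M) ℂ)
    (s : Fin k → Fin t → Pos n) (ψ : Memory n k t M → ℂ) {m : ℕ} (hm : m ≤ k) :
    branchSum m (fun o => weight 1 (run U x s o ψ m)) = weight 1 ψ := by
  have := branchSum_weight_run_eq (U := U) (x := x) s ψ 1 1 (Nat.zero_le m) hm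
    (fun _ _ _ _ _ => rfl) fun j _ _ φ => weight_one_mulVec (hU j) φ
  simpa [branchSum, run] using this

/-- Acceptance of a register that is far from the emitted note is unlikely. -/
theorem expect_accepted_far_le (hU : ∀ j, U j ∈ Matrix.unitaryGroup (Memory n k t M) ℂ)
    (ψ : Memory n k t M → ℂ) (i : Fin k) :
    𝔼 s : Fin k → Fin t → Pos n, branchSum (i + 1) (fun o =>
        (if o i = sampleAt x (s i) then 1 else 0)
          * weight (contentIn i (far x)) (run U x s o ψ (i + 1)))
      ≤ (31 / 32) ^ t * weight 1 ψ := by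
  have h1 : ∀ s : Fin k → Fin t → Pos n, branchSum (i + 1) (fun o =>
        (if o i = sampleAt x (s i) then 1 else 0)
          * weight (contentIn i (far x)) (run U x s o ψ (i + 1)))
      = branchSum i fun o => weight (contentIn i (far x))
          (observe i (s i) (sampleAt x (s i)) ((U i).mulVec (run U x s o ψ i))) := by
    intro s
    rw [branchSum_succ]
    congr 1
    ext o
    simp_rw [run_succ, run_update_outcome, Function.update_self, weight_step]
    simp
  -- For a vector independent of the sample, the average can be taken label by label, where the
  -- classical estimate applies.
  have h2 : ∀ φ : Memory n k t M → ℂ, 𝔼 σ : Fin t → Pos n,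
      weight (contentIn i (far x)) (observe i σ (sampleAt x σ) φ) ≤ (31 / 32) ^ t * weight 1 φ := by
    intro φ
    simp only [weight]
    rw [Finset.expect_sum_comm, Finset.mul_sum]
    refine Finset.sum_le_sum fun w _ => ?_
    by_cases h : w.1.1 i ∈ far x
    · calc 𝔼 σ : Fin t → Pos n,
            contentIn i (far x) w.1.1 * ‖observe i σ (sampleAt x σ) φ w‖ ^ 2
          = (𝔼 σ : Fin t → Pos n, if sampleAt (w.1.1 i) σ = sampleAt x σ then (1 : ℝ) else 0)
              * ‖φ w‖ ^ 2 := by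
            rw [Finset.expect_mul]
            refine Finset.expect_congr rfl fun σ _ => ?_
            simp only [contentIn, if_pos h, observe, presented]
            by_cases h' : sampleAt (w.1.1 i) σ = sampleAt x σ <;> simp [h']
        _ ≤ (31 / 32) ^ t * ‖φ w‖ ^ 2 := by gcongr; exact expect_sampleAt_eq_le h t
        _ = _ := by simp
    · simp only [contentIn, if_neg h, zero_mul, Finset.expect_const_zero]
      simp only [Pi.one_apply]; positivity
  simp_rw [h1]
  -- The state before inquiry `i` does not depend on `s i`, so that sample may be redrawn against a
  -- fixed state.
  rw [← expect_update _ i]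
  calc _ = 𝔼 s : Fin k → Fin t → Pos n, branchSum i fun o => 𝔼 σ : Fin t → Pos n,
          weight (contentIn i (far x))
            (observe i σ (sampleAt x σ) ((U i).mulVec (run U x s o ψ i))) := by
        simp_rw [branchSum_expect, run_update_sample, Function.update_self]
    _ ≤ 𝔼 s : Fin k → Fin t → Pos n, branchSum i fun o =>
          (31 / 32) ^ t * weight 1 (run U x s o ψ i) := by
        refine Finset.expect_le_expect fun s _ => branchSum_mono _ fun o => ?_
        rw [← weight_one_mulVec (hU i)]
        exact h2 _
    _ = 𝔼 s : Fin k → Fin t → Pos n, (31 / 32) ^ t * weight 1 ψ := by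
        refine Finset.expect_congr rfl fun s _ => ?_
        rw [← branchSum_weight_one_run (x := x) hU s ψ i.2.le, branchSum, branchSum,
          ← Finset.mul_expect]
        ring
    _ = (31 / 32) ^ t * weight 1 ψ := Fintype.expect_const _

/-! ### Unitality of a whole run -/

/-- Inquiries with fixed operations keep the maximally mixed state below itself. -/
theorem branchSum_dotProduct_run (hU : ∀ j, U j ∈ Matrix.unitaryGroup (Memory n k t M) ℂ)
    (s : Fin k → Fin t → Pos n) (φ : Memory n k t M → ℂ) {m : ℕ} (hm : m ≤ k) :
    branchSum m (fun o => ∑ e, ‖φ ⬝ᵥ run U x s o (Pi.single e 1) m‖ ^ 2) = weight 1 φ := by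
  -- The last inquiry is moved onto the test vector, so `φ` must vary.
  induction m generalizing φ with
  | zero => simp [branchSum, run, weight]
  | succ m ih =>
    obtain ⟨j, rfl⟩ : ∃ j : Fin k, (j : ℕ) = m := ⟨⟨m, by omega⟩, rfl⟩
    rw [branchSum_succ]
    simp_rw [run_succ, run_update_outcome, Function.update_self, dotProduct_step]
    rw [branchSum_sum, ← sum_weight_backStep (hU j) x j (s j) φ]
    exact Finset.sum_congr rfl fun v _ => ih _ (by omega)

theorem branchSum_sum_weight_run (hU : ∀ j, U j ∈ Matrix.unitaryGroup (Memory n k t M) ℂ)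
    (s : Fin k → Fin t → Pos n) (f : (Fin k → Note n) → ℝ) {m : ℕ} (hm : m ≤ k) :
    branchSum m (fun o => ∑ e, weight f (run U x s o (Pi.single e 1) m))
      = ∑ w : Memory n k t M, f w.1.1 := by
  have h : ∀ w : Memory n k t M, branchSum m (fun o => ∑ e : Memory n k t M,
      ‖run U x s o (Pi.single e 1) m w‖ ^ 2) = 1 := by
    intro w
    have := branchSum_dotProduct_run (x := x) hU s (Pi.single w 1) hm
    simpa [single_dotProduct, weight, Pi.single_apply, apply_ite] using this
  have hcomm : ∀ o, ∑ e : Memory n k t M, weight f (run U x s o (Pi.single e 1) m)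
      = ∑ w : Memory n k t M, f w.1.1 *
          ∑ e : Memory n k t M, ‖run U x s o (Pi.single e 1) m w‖ ^ 2 := by
    intro o
    simp_rw [weight, Finset.mul_sum]
    exact Finset.sum_comm
  simp_rw [hcomm]
  rw [branchSum_sum]
  refine Finset.sum_congr rfl fun w _ => ?_
  rw [branchSum, ← Finset.mul_expect, mul_left_comm]
  exact (congrArg _ (h w)).trans (mul_one _)

end Inquiries

/-! ### Two accepted registers under fixed operations -/

section Bound

variable {n k t M : ℕ} {U : Fin k → Matrix (Memory n k t M) (Memory n k t M) ℂ} {x : Note n}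

theorem weight_one_initial (r : Ambient n k t M) : weight 1 (initial x r) = 1 := by
  simp [weight, initial, Pi.single_apply, apply_ite]

/-- In the maximally mixed state, two registers are rarely both in `B`. -/
theorem sum_contentIn_mul_contentIn {i j : Fin k} (hij : i ≠ j) (B : Finset (Note n)) :
    ∑ w : Memory n k t M, contentIn i B w.1.1 * contentIn j B w.1.1
      = Fintype.card (Ambient n k t M) * ((B.card : ℝ) ^ 2 / 2 ^ 2 ^ n) := by
  have hav : ∀ p : Fin k → Note n, 𝔼 b : Note n, contentIn i B (Function.update p i b)
      = (B.card : ℝ) / 2 ^ 2 ^ (n + 1) := by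
    intro p
    simp [contentIn, Fintype.expect_eq_sum_div_card, ZMod.card]
  have hav' : ∀ p : Fin k → Note n, 𝔼 b : Note n, contentIn j B (Function.update p j b)
      = (B.card : ℝ) / 2 ^ 2 ^ (n + 1) := by
    intro p
    simp [contentIn, Fintype.expect_eq_sum_div_card, ZMod.card]
  have hpair : 𝔼 p : Fin k → Note n, contentIn i B p * contentIn j B p
      = ((B.card : ℝ) / 2 ^ 2 ^ (n + 1)) ^ 2 := by
    have hj : ∀ (p : Fin k → Note n) b,
        contentIn j B (Function.update p i b) = contentIn j B p := by
      intro p b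
      simp [contentIn, Function.update_of_ne hij.symm]
    rw [← expect_update _ i]
    simp_rw [hj, ← Finset.expect_mul, hav, ← Finset.mul_expect]
    rw [← expect_update _ j]
    simp_rw [hav']
    rw [Fintype.expect_const, sq]
  have hsum : ∑ p : Fin k → Note n, contentIn i B p * contentIn j B p
      = Fintype.card (Fin k → Note n) * ((B.card : ℝ) / 2 ^ 2 ^ (n + 1)) ^ 2 := by
    rw [← hpair, Fintype.card_mul_expect]
  -- The genuine note and the blank qubits contribute N + 2^n to the exponent and the two tested
  -- registers remove 2N; as N = 2 · 2^n, a net 2^n is removed.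
  have hN : (2 : ℝ) ^ 2 ^ (n + 1) = 2 ^ 2 ^ n * 2 ^ 2 ^ n := by rw [← pow_add]; ring_nf
  simp_rw [Fintype.sum_prod_type, Finset.sum_const, nsmul_eq_mul, ← Finset.mul_sum]
  rw [hsum]
  simp only [Ambient, Finset.card_univ, Fintype.card_prod, Nat.cast_mul]
  have hnote : (Fintype.card (Note n) : ℝ) = 2 ^ 2 ^ (n + 1) := by simp [ZMod.card]
  have hblank : (Fintype.card (Fin (2 ^ n) → Bit) : ℝ) = 2 ^ 2 ^ n := by simp [ZMod.card]
  rw [hnote, hblank, hN]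
  have : (2 : ℝ) ^ 2 ^ n ≠ 0 := by positivity
  field_simp

/-- With `2 ^ n` blank qubits, two registers are rarely both near the emitted note. -/
theorem expect_branchSum_both_near_le (hU : ∀ j, U j ∈ Matrix.unitaryGroup (Memory n k t M) ℂ)
    (s : Fin k → Fin t → Pos n) {i j : Fin k} (hij : i ≠ j) {m : ℕ} (hm : m ≤ k) :
    𝔼 r : Ambient n k t M, branchSum m (fun o =>
        weight (contentIn i (far x)ᶜ * contentIn j (far x)ᶜ) (run U x s o (initial x r) m))
      ≤ (31 / 32) ^ n := by
  set f : (Fin k → Note n) → ℝ := contentIn i (far x)ᶜ * contentIn j (far x)ᶜ with hf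
  have hf0 : ∀ p, 0 ≤ f p := fun p => mul_nonneg (contentIn_nonneg _ _ _) (contentIn_nonneg _ _ _)
  have hle : ∑ r : Ambient n k t M, branchSum m (fun o => weight f (run U x s o (initial x r) m))
      ≤ ∑ w : Memory n k t M, f w.1.1 := by
    rw [← branchSum_sum_weight_run (x := x) hU s f hm, ← branchSum_sum]
    refine branchSum_mono m fun o => ?_
    rw [Fintype.sum_prod_type fun e : Memory n k t M =>
      weight f (run U x s o (Pi.single e 1) m)]
    refine Finset.sum_le_sum fun r _ => ?_
    -- Domination by the maximally mixed state: the actual start `(x, 0)` is one of the nonnegative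
    -- terms.
    exact Finset.single_le_sum (f := fun e => weight f (run U x s o (Pi.single (r, e) 1) m))
      (fun _ _ => weight_nonneg hf0 _) (Finset.mem_univ (x, 0))
  rw [Fintype.expect_eq_sum_div_card, div_le_iff₀ (by exact_mod_cast Fintype.card_pos), mul_comm]
  refine hle.trans ?_
  simp only [hf, Pi.mul_apply]
  rw [sum_contentIn_mul_contentIn hij]
  gcongr
  rw [div_le_iff₀ (by positivity)]
  exact card_near_sq_le x

theorem one_le_contentIn_add (i j : Fin k) (B : Finset (Note n)) (p : Fin k → Note n) :
    (1 : (Fin k → Note n) → ℝ) p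
      ≤ (contentIn i B + contentIn j B + contentIn i Bᶜ * contentIn j Bᶜ) p := by
  by_cases hi : p i ∈ B <;> by_cases hj : p j ∈ B <;> simp [contentIn, hi, hj]

/-- The register presented at `i` is accepted, it is kept until inquiry `j`, and the register
presented at `j` is accepted too: this is unlikely if the operations ignore the verdicts. -/
theorem expect_two_accepted_le (hU : ∀ j, U j ∈ Matrix.unitaryGroup (Memory n k t M) ℂ)
    {i j : Fin k} (hij : i < j) (hheld : ∀ l, i < l → l ≤ j → ActsTriviallyOn i (U l)) :
    𝔼 s : Fin k → Fin t → Pos n, 𝔼 r : Ambient n k t M, ∑ o : Fin k → Fin t → Bit,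
        (if o i = sampleAt x (s i) ∧ o j = sampleAt x (s j) then 1 else 0)
          * weight 1 (run U x s o (initial x r) k)
      ≤ 3 * (31 / 32) ^ min n t := by
  have hpos : ∀ p : Prop, [Decidable p] → (0 : ℝ) ≤ if p then 1 else 0 :=
    fun p _ => by split_ifs <;> norm_num
  have hsplit : ∀ (s : Fin k → Fin t → Pos n) (r : Ambient n k t M),
      ∑ o : Fin k → Fin t → Bit, (if o i = sampleAt x (s i) ∧ o j = sampleAt x (s j) then 1 else 0)
          * weight 1 (run U x s o (initial x r) k)
        ≤ branchSum (i + 1) (fun o => (if o i = sampleAt x (s i) then 1 else 0)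
            * weight (contentIn i (far x)) (run U x s o (initial x r) (i + 1)))
          + branchSum (j + 1) (fun o => (if o j = sampleAt x (s j) then 1 else 0)
            * weight (contentIn j (far x)) (run U x s o (initial x r) (j + 1)))
          + branchSum (j + 1) (fun o => weight (contentIn i (far x)ᶜ * contentIn j (far x)ᶜ)
              (run U x s o (initial x r) (j + 1))) := by
    intro s r
    -- All three terms are brought to the moment just after inquiry `j`: later inquiries are summed
    -- out, and the far weight of register `i` is carried forward while it is kept.
    rw [← branchSum_total, branchSum_weight_run_eq (a := j + 1) s _ _ 1 (by omega) le_rfl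
        (fun l hl _ o v => by
          rw [Function.update_of_ne (by rintro rfl; omega),
            Function.update_of_ne (by rintro rfl; omega)])
        fun l _ _ φ => weight_one_mulVec (hU l) φ,
      ← branchSum_weight_run_eq (a := i + 1) (b := j + 1) s _
        (fun o => if o i = sampleAt x (s i) then 1 else 0) (contentIn i (far x)) (by omega) (by omega)
        (fun l hl _ o v => by rw [Function.update_of_ne (by rintro rfl; omega)])
        fun l h1 h2 φ => weight_contentIn_mulVec (hU l) (hheld l (by omega) (by omega)) _ φ,
      ← branchSum_add, ← branchSum_add]
    refine branchSum_mono _ fun o => ?_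
    have h1 := weight_mono (one_le_contentIn_add i j (far x)) (run U x s o (initial x r) (j + 1))
    rw [weight_add, weight_add] at h1
    have h2 := weight_nonneg (contentIn_nonneg i (far x)) (run U x s o (initial x r) (j + 1))
    have h3 := weight_nonneg (contentIn_nonneg j (far x)) (run U x s o (initial x r) (j + 1))
    have h4 := weight_nonneg (f := contentIn i (far x)ᶜ * contentIn j (far x)ᶜ)
      (fun p => mul_nonneg (contentIn_nonneg _ _ _) (contentIn_nonneg _ _ _))
      (run U x s o (initial x r) (j + 1))
    by_cases hi : o i = sampleAt x (s i) <;> by_cases hj : o j = sampleAt x (s j) <;>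
      simp only [hi, hj, and_self, and_true, and_false, if_true, if_false] <;> linarith
  have hq : ∀ a, min n t ≤ a → ((31 : ℝ) / 32) ^ a ≤ (31 / 32) ^ min n t :=
    fun a ha => pow_le_pow_of_le_one (by norm_num) (by norm_num) ha
  have hfar : ∀ l : Fin k, 𝔼 s : Fin k → Fin t → Pos n, 𝔼 r : Ambient n k t M,
      branchSum (l + 1) (fun o => (if o l = sampleAt x (s l) then 1 else 0)
        * weight (contentIn l (far x)) (run U x s o (initial x r) (l + 1)))
      ≤ (31 / 32) ^ min n t := by
    intro l
    rw [Finset.expect_comm]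
    refine Finset.expect_le Finset.univ_nonempty fun r _ => ?_
    have := expect_accepted_far_le (x := x) hU (initial x r) l
    rw [weight_one_initial, mul_one] at this
    exact this.trans (hq t (min_le_right _ _))
  refine (Finset.expect_le_expect fun s _ => Finset.expect_le_expect fun r _ => hsplit s r).trans ?_
  simp_rw [Finset.expect_add_distrib]
  have hnear : 𝔼 s : Fin k → Fin t → Pos n, 𝔼 r : Ambient n k t M, branchSum (j + 1) (fun o =>
      weight (contentIn i (far x)ᶜ * contentIn j (far x)ᶜ)
        (run U x s o (initial x r) (j + 1))) ≤ (31 / 32) ^ min n t :=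
    Finset.expect_le Finset.univ_nonempty fun s _ =>
      (expect_branchSum_both_near_le hU s hij.ne (by omega)).trans (hq n (min_le_left _ _))
  linarith [hfar i, hfar j]

/-! ### From adaptive adversaries to fixed operations -/

/-- The operations of an adversary when the verdicts are as in the table `h`. -/
def Adversary.opsFor (A : Adversary n k t M) (h : Fin k → Bool) (j : Fin k) :
    Matrix (Memory n k t M) (Memory n k t M) ℂ :=
  A.op j fun i => h i

theorem stateAfter_eq_run (A : Adversary n k t M) (x : Note n) (s : Fin k → Fin t → Pos n)
    (o : Fin k → Fin t → Bit) (r : Ambient n k t M) (m : ℕ) :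
    stateAfter A x s o r m = run (A.opsFor (verdict x s o)) x s o (initial x r) m := by
  induction m with
  | zero => rfl
  | succ m ih => simp only [stateAfter, run, ih]; rfl

/-- With the verdicts in the table `h`, the register presented at `i` is kept from its inquiry
up to inquiry `j`. -/
def Adversary.Keeps (A : Adversary n k t M) (h : Fin k → Bool) (i j : Fin k) : Prop :=
  i < j ∧ ∀ l, i < l → l ≤ j → i ∈ A.held l fun a => h a

open Classical in
/-- Union bound over the tables of verdicts and the pairs of inquiries. -/
theorem forgeProb_le (A : Adversary n k t M) :
    forgeProb A ≤ 2 ^ k * k ^ 2 * 3 * (31 / 32) ^ min n t := by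
  -- Of the agreement between `h` and the true verdicts only acceptance at `i` and `j` is retained.
  -- This overcounts, but makes the operations independent of the outcomes.
  let T : Note n → (Fin k → Fin t → Pos n) → Ambient n k t M → (Fin k → Fin t → Bit) →
      (Fin k → Bool) → Fin k → Fin k → ℝ := fun x s r o h i j =>
    if A.Keeps h i j then (if o i = sampleAt x (s i) ∧ o j = sampleAt x (s j) then 1 else 0)
      * weight 1 (run (A.opsFor h) x s o (initial x r) k) else 0
  have hT0 : ∀ x s r o h i j, 0 ≤ T x s r o h i j := by
    intro x s r o h i j
    have := weight_nonneg (f := 1) (fun _ => zero_le_one) (run (A.opsFor h) x s o (initial x r) k)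
    simp only [T]
    split_ifs
    · simpa using this
    · simp
    · exact le_rfl
  have hcover : ∀ x s r o, (if Forged A x s o then branchProb A x s r o else 0)
      ≤ ∑ y : (Fin k → Bool) × Fin k × Fin k, T x s r o y.1 y.2.1 y.2.2 := by
    intro x s r o
    split_ifs with hF
    · obtain ⟨i, j, hij, hi, hj, hl⟩ := hF
      calc branchProb A x s r o = T x s r o (verdict x s o) i j := by
            have hK : A.Keeps (verdict x s o) i j := ⟨hij, hl⟩
            have hij' : o i = sampleAt x (s i) ∧ o j = sampleAt x (s j) :=
              ⟨of_decide_eq_true hi, of_decide_eq_true hj⟩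
            simp only [T, if_pos hK, if_pos hij', branchProb, stateAfter_eq_run, weight]
            simp
        _ ≤ ∑ y : (Fin k → Bool) × Fin k × Fin k, T x s r o y.1 y.2.1 y.2.2 :=
            Finset.single_le_sum
              (f := fun y : (Fin k → Bool) × Fin k × Fin k => T x s r o y.1 y.2.1 y.2.2)
              (fun _ _ => hT0 _ _ _ _ _ _ _) (Finset.mem_univ (verdict x s o, i, j))
    · exact Finset.sum_nonneg fun _ _ => hT0 _ _ _ _ _ _ _
  have hterm : ∀ h i j x, 𝔼 s, 𝔼 r, ∑ o, T x s r o h i j ≤ 3 * (31 / 32) ^ min n t := by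
    intro h i j x
    by_cases hK : A.Keeps h i j
    · simp only [T, if_pos hK]
      exact expect_two_accepted_le (fun l => A.op_unitary l _) hK.1
        fun l h1 h2 => A.op_trivial l _ i (hK.2 l h1 h2)
    · simp only [T, if_neg hK, Finset.sum_const_zero, Finset.expect_const_zero]
      positivity
  have hx : ∀ x, 𝔼 s, 𝔼 r, ∑ o, (if Forged A x s o then branchProb A x s r o else 0)
      ≤ 2 ^ k * k ^ 2 * 3 * (31 / 32) ^ min n t := by
    intro x
    calc 𝔼 s, 𝔼 r, ∑ o, (if Forged A x s o then branchProb A x s r o else 0)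
        ≤ 𝔼 s, 𝔼 r, ∑ o, ∑ y : (Fin k → Bool) × Fin k × Fin k,
            T x s r o y.1 y.2.1 y.2.2 :=
          Finset.expect_le_expect fun s _ => Finset.expect_le_expect fun r _ =>
            Finset.sum_le_sum fun o _ => hcover x s r o
      _ = 𝔼 s, 𝔼 r, ∑ y : (Fin k → Bool) × Fin k × Fin k, ∑ o, T x s r o y.1 y.2.1 y.2.2 := by
          refine Finset.expect_congr rfl fun s _ => Finset.expect_congr rfl fun r _ => ?_
          exact Finset.sum_comm
      _ = ∑ y : (Fin k → Bool) × Fin k × Fin k, 𝔼 s, 𝔼 r, ∑ o, T x s r o y.1 y.2.1 y.2.2 := by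
          simp_rw [Finset.expect_sum_comm]
      _ ≤ ∑ _y : (Fin k → Bool) × Fin k × Fin k, 3 * (31 / 32) ^ min n t :=
          Finset.sum_le_sum fun y _ => hterm _ _ _ x
      _ = 2 ^ k * k ^ 2 * 3 * (31 / 32) ^ min n t := by
          simp
          ring
  exact Finset.expect_le Finset.univ_nonempty fun x _ => hx x

end Bound

end Banknote

theorem theorem6 :
    ∃ c : ℝ, 0 < c ∧ ∀ k : ℕ, ∃ C : ℝ, 0 < C ∧
      ∀ (n t M : ℕ) (A : Banknote.Adversary n k t M),
        Banknote.forgeProb A ≤ C * (2 : ℝ) ^ (-(c * (min n t : ℕ))) := by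
  -- With this `c`, 2^(-c m) is exactly (31/32)^m. The `+ 1` keeps `C` positive when `k = 0`.
  refine ⟨-Real.logb 2 (31 / 32), neg_pos.2 (Real.logb_neg (by norm_num) (by norm_num)
    (by norm_num)), fun k => ⟨2 ^ k * k ^ 2 * 3 + 1, by positivity, fun n t M A => ?_⟩⟩
  rw [neg_mul, neg_neg, Real.rpow_mul (by norm_num), Real.rpow_logb (by norm_num) (by norm_num)
    (by norm_num), Real.rpow_natCast]
  refine (Banknote.forgeProb_le A).trans ?_
  gcongr
  linarith
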